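/- Let $\mathbb{F}=\mathbb{R}$ or $\mathbb{F}=\mathbb{C}$. Let $X$ be a proper metric space (closed bounded subsets are compact), let $\mathrm{C}_0(X)$ be the algebra of continuous $\mathbb{F}$-valued functions on $X$ vanishing at infinity, let $\mathcal{H}$ be a separable Hilbert space over $\mathbb{F}$, and let $\varrho\colon \mathrm{C}_0(X)\to\mathbb{B}(\mathcal{H})$ be a nondegenerate $^*$-representation. An operator $T\in\mathbb{B}(\mathcal{H})$ is *locally compact* if $\varrho(f)T$ and $T\varrho(f)$ are compact for all $f\in \mathrm{C}_0(X)$. Its *support* is the subset of $X\times X$ whose complement consists of all $(x,y)$ for which there are neighbourhoods $U_x$ of $x$ and $U_y$ of $y$ with $\varrho(f)T\varrho(g)=0$ for all $f,g\in \mathrm{C}_0(X)$ vanishing outside $U_x$ and $U_y$, respectively. The operator $T$ is *controlled* if there is $R>0$ with $d(x,y)\le R$ for all $(x,y)\in\operatorname{supp}T$. The locally compact, controlled operators form a $^*$-algebra; its norm closure in $\mathbb{B}(\mathcal{H})$ is the *Roe $\mathrm{C}^*$-algebra* $\mathrm{C}^*_{\mathrm{Roe}}(X,\varrho)$. The representation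 $\varrho$ is *ample* if $\varrho(f)$ is compact only for $f=0$. A *coarse map* $f\colon X\to Y$ between proper metric spaces is a Borel map such that for every $R>0$ there is $S>0$ such that $d(x,y)\le R$ implies $d(f(x),f(y))\le S$, and such that preimages of bounded sets are bounded. Two maps $f_0,f_1$ are *close* if there is $R>0$ with $d(f_0(x),f_1(x))<R$ for all $x$. The spaces $X$ and $Y$ are *coarsely equivalent* if there are coarse maps $f\colon X\to Y$ and $g\colon Y\to X$ such that $g\circ f$ and $f\circ g$ are close to the identity maps on $X$ and $Y$, respectively. **Theorem.** Let $X$ and $Y$ be coarsely equivalent proper metric spaces. Let $\mathbb{F}$ be $\mathbb{R}$ or $\mathbb{C}$, and let $\varrho_X$ and $\varrho_Y$ be ample nondegenerate representations of $\mathrm{C}_0(X)$ and $\mathrm{C}_0(Y)$ on separable Hilbert spaces over $\mathbb{F}$. Then there is a $^*$-isomorphism $$\mathrm{C}^*_{\mathrm{Roe}}(X,\varrho_X)\cong \mathrm{C}^*_{\mathrm{Roe}}(Y,\varrho_Y)$$ of $\mathrm{C}^*$-algebras over $\mathbb{F}$. That is, $\mathrm{C}^*_{\mathrm{Roe}}(X)_{\mathbb{R}}\cong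 \mathrm{C}^*_{\mathrm{Roe}}(Y)_{\mathbb{R}}$ and $\mathrm{C}^*_{\mathrm{Roe}}(X)_{\mathbb{C}}\cong \mathrm{C}^*_{\mathrm{Roe}}(Y)_{\mathbb{C}}$. -/

import Mathlib

open scoped ZeroAtInfty Topology

noncomputable section

namespace CoarseRoe

section Coarse

variable {X Y : Type*} [MetricSpace X] [MetricSpace Y]

/-- Two maps into a metric space are close if they are at uniformly bounded distance. -/
def Close {Z : Type*} (f₀ f₁ : Z → Y) : Prop :=
  ∃ R : ℝ, 0 < R ∧ ∀ x, dist (f₀ x) (f₁ x) < R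

/-- A coarse map: Borel, uniformly expansive, and with bounded preimages of bounded sets. -/
structure IsCoarseMap [MeasurableSpace X] [MeasurableSpace Y] (f : X → Y) : Prop where
  measurable : Measurable f
  expansive : ∀ R : ℝ, 0 < R → ∃ S : ℝ, 0 < S ∧ ∀ x y, dist x y ≤ R → dist (f x) (f y) ≤ S
  metricallyProper : ∀ B : Set Y, Bornology.IsBounded B → Bornology.IsBounded (f ⁻¹' B)

/-- A coarse equivalence: a coarse map with a coarse inverse. -/
def IsCoarseEquivalence [MeasurableSpace X] [MeasurableSpace Y] (f : X → Y) : Prop :=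
  IsCoarseMap f ∧ ∃ g : Y → X, IsCoarseMap g ∧ Close (g ∘ f) id ∧ Close (f ∘ g) id

variable (X Y) in
/-- Two metric spaces (with their Borel `σ`-algebras) are coarsely equivalent. -/
def CoarselyEquivalent [MeasurableSpace X] [MeasurableSpace Y] : Prop :=
  ∃ f : X → Y, IsCoarseEquivalence f

end Coarse

section Representation

variable {𝕜 : Type*} [RCLike 𝕜] {X : Type*} [MetricSpace X]
  {H : Type*} [NormedAddCommGroup H] [InnerProductSpace 𝕜 H] [CompleteSpace H]

/-- A representation of `C₀(X)` on `H` is nondegenerate if the vectors `ρ(f)v` span a dense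
subspace of `H`. -/
def IsNondegenerate (ρ : C₀(X, 𝕜) →⋆ₙₐ[𝕜] (H →L[𝕜] H)) : Prop :=
  (Submodule.span 𝕜 {w : H | ∃ (f : C₀(X, 𝕜)) (v : H), ρ f v = w}).topologicalClosure = ⊤

/-- A representation is ample if `ρ(f)` is compact only for `f = 0`. -/
def IsAmple (ρ : C₀(X, 𝕜) →⋆ₙₐ[𝕜] (H →L[𝕜] H)) : Prop :=
  ∀ f : C₀(X, 𝕜), IsCompactOperator (ρ f) → f = 0

/-- Locally compact operators: `ρ(f)T` and `Tρ(f)` are compact for all `f`. -/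
def IsLocallyCompact (ρ : C₀(X, 𝕜) →⋆ₙₐ[𝕜] (H →L[𝕜] H)) (T : H →L[𝕜] H) : Prop :=
  ∀ f : C₀(X, 𝕜), IsCompactOperator (ρ f * T) ∧ IsCompactOperator (T * ρ f)

/-- The complement of the support of `T` consists of all `(x, y)` for which there are
neighbourhoods `U` of `x` and `V` of `y` with `ρ(f) T ρ(g) = 0` for all `f ∈ C₀(U)`, `g ∈ C₀(V)`.
Here `C₀(U)` is the set of those functions in `C₀(X)` that vanish outside `U`. -/
def operatorSupport (ρ : C₀(X, 𝕜) →⋆ₙₐ[𝕜] (H →L[𝕜] H)) (T : H →L[𝕜] H) : Set (X × X) :=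
  {p | ∃ U ∈ 𝓝 p.1, ∃ V ∈ 𝓝 p.2, ∀ f g : C₀(X, 𝕜),
    (∀ z ∉ U, f z = 0) → (∀ z ∉ V, g z = 0) → ρ f * T * ρ g = 0}ᶜ

/-- Controlled operators (operators of finite propagation). -/
def IsControlled (ρ : C₀(X, 𝕜) →⋆ₙₐ[𝕜] (H →L[𝕜] H)) (T : H →L[𝕜] H) : Prop :=
  ∃ R : ℝ, 0 < R ∧ ∀ x y, (x, y) ∈ operatorSupport ρ T → dist x y ≤ R

/-! ### The locally compact, controlled operators form a `*`-algebra -/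

section Functions

/-- A compactly supported real function as an element of `C₀(X, 𝕜)`. -/
def bump (χ : C(X, ℝ)) (hχ : HasCompactSupport χ) : C₀(X, 𝕜) where
  toFun x := (χ x : 𝕜)
  continuous_toFun := by fun_prop
  zero_at_infty' := by
    have : HasCompactSupport (fun x => (χ x : 𝕜)) :=
      hχ.comp_left (g := fun t : ℝ => (t : 𝕜)) (by simp)
    exact this.is_zero_at_infty

lemma bump_apply (χ : C(X, ℝ)) (hχ : HasCompactSupport χ) (x : X) :
    (bump χ hχ : C₀(X, 𝕜)) x = (χ x : 𝕜) := rfl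

/-- An additive property of functions in `C₀(X)` that holds locally on a compact set holds for all
functions vanishing outside that compact set. -/
lemma local_induction [ProperSpace X] {P : C₀(X, 𝕜) → Prop} (h0 : P 0)
    (hadd : ∀ f g, P f → P g → P (f + g)) {K : Set X} (hK : IsCompact K)
    (hloc : ∀ a ∈ K, ∃ U ∈ 𝓝 a, ∀ h : C₀(X, 𝕜), (∀ z ∉ U, h z = 0) → P h)
    (f : C₀(X, 𝕜)) (hf : ∀ z ∉ K, f z = 0) : P f := by
  have hloc' : ∀ a : K, ∃ U : Set X, IsOpen U ∧ a.1 ∈ U ∧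
      ∀ h : C₀(X, 𝕜), (∀ z ∉ U, h z = 0) → P h := by
    intro a
    obtain ⟨U, hU, h⟩ := hloc a.1 a.2
    obtain ⟨W, hWU, hW, haW⟩ := mem_nhds_iff.1 hU
    exact ⟨W, hW, haW, fun k hk => h k fun z hz => hk z fun hz' => hz (hWU hz')⟩
  choose U hUo hUm hUP using hloc'
  obtain ⟨t, ht⟩ := hK.elim_finite_subcover U hUo
    (fun a ha => Set.mem_iUnion.2 ⟨⟨a, ha⟩, hUm ⟨a, ha⟩⟩)
  let e := t.equivFin
  obtain ⟨χ, hχs, hχ1, -, hχc⟩ := exists_continuous_sum_one_of_isOpen_isCompact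
    (s := fun i : Fin t.card => U (e.symm i).1) (fun i => hUo _) hK (by
      intro x hx
      obtain ⟨a, hat, hxa⟩ := Set.mem_iUnion₂.1 (ht hx)
      exact Set.mem_iUnion.2 ⟨e ⟨a, hat⟩, by simpa using hxa⟩)
  have key : f = ∑ i, bump (χ i) (hχc i) * f := by
    ext x
    have h1 : (∑ i, (bump (χ i) (hχc i) * f : C₀(X, 𝕜))) x
        = ∑ i, (bump (χ i) (hχc i) * f : C₀(X, 𝕜)) x := by
      let φ : C₀(X, 𝕜) →+ 𝕜 :=
        { toFun := fun h => h x, map_zero' := rfl, map_add' := fun _ _ => rfl }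
      exact map_sum φ _ _
    rw [h1]
    by_cases hx : x ∈ K
    · have := hχ1 hx
      simp only [Finset.sum_apply, Pi.one_apply] at this
      simp only [ZeroAtInftyContinuousMap.mul_apply, bump_apply, ← Finset.sum_mul]
      rw [← RCLike.ofReal_sum, this]
      simp
    · simp [hf x hx]
  rw [key]
  refine Finset.sum_induction _ P hadd h0 fun i _ => hUP (e.symm i).1 _ fun z hz => ?_
  have : χ i z = 0 := image_eq_zero_of_notMem_tsupport fun h => hz (hχs i h)
  simp [bump_apply, this]

/-- Functions in `C₀(X)` are approximated by compactly supported multiples. -/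
lemma exists_bump_approx [ProperSpace X] (g : C₀(X, 𝕜)) {ε : ℝ} (hε : 0 < ε) :
    ∃ (χ : C(X, ℝ)) (hχ : HasCompactSupport χ), ‖g - bump χ hχ * g‖ ≤ ε := by
  have h := Metric.tendsto_nhds.1 g.zero_at_infty' ε hε
  obtain ⟨K, hK, hKs⟩ := Filter.mem_cocompact.1 h
  obtain ⟨χ, hχ1, -, hχc, hχb⟩ := exists_continuous_one_zero_of_isCompact hK isClosed_empty
    (Set.disjoint_empty K)
  refine ⟨χ, hχc, ?_⟩
  rw [← ZeroAtInftyContinuousMap.norm_toBCF_eq_norm]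
  refine (BoundedContinuousFunction.norm_le hε.le).2 fun x => ?_
  change ‖g x - (χ x : 𝕜) * g x‖ ≤ ε
  by_cases hx : x ∈ K
  · have : χ x = 1 := hχ1 hx
    simp [this, hε.le]
  · have h1 : ‖g x‖ < ε := by simpa using hKs hx
    have h2 : g x - (χ x : 𝕜) * g x = ((1 - χ x : ℝ) : 𝕜) * g x := by
      push_cast; ring
    rw [h2, norm_mul, RCLike.norm_ofReal, abs_of_nonneg (by linarith [(hχb x).2])]
    calc (1 - χ x) * ‖g x‖ ≤ 1 * ‖g x‖ := by
          gcongr; linarith [(hχb x).1]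
      _ ≤ ε := by linarith

end Functions

/-- Representations of `C₀(X)` are contractive. -/
lemma norm_rep_le (ρ : C₀(X, 𝕜) →⋆ₙₐ[𝕜] (H →L[𝕜] H)) (f : C₀(X, 𝕜)) : ‖ρ f‖ ≤ ‖f‖ := by
  set c : ℝ := ‖f‖ with hc
  have hfc : ∀ x, ‖f x‖ ≤ c := fun x => f.toBCF.norm_coe_le_norm x
  let h : C₀(X, 𝕜) :=
    { toFun := fun x => ((c - √(c ^ 2 - ‖f x‖ ^ 2) : ℝ) : 𝕜)
      continuous_toFun := by fun_prop
      zero_at_infty' := by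
        have h0 : Filter.Tendsto f (Filter.cocompact X) (𝓝 0) := f.zero_at_infty'
        have hcont : Continuous fun z : 𝕜 => ((c - √(c ^ 2 - ‖z‖ ^ 2) : ℝ) : 𝕜) := by fun_prop
        have := (hcont.tendsto 0).comp h0
        simpa [Function.comp_def, Real.sqrt_sq (norm_nonneg f), hc] using this }
  have hstar : star h = h := by
    ext x
    change star (((c - √(c ^ 2 - ‖f x‖ ^ 2) : ℝ) : 𝕜)) = ((c - √(c ^ 2 - ‖f x‖ ^ 2) : ℝ) : 𝕜)
    simp
  have hid : star f * f + h * h = (2 * c : 𝕜) • h := by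
    ext x
    change star (f x) * f x + ((c - √(c ^ 2 - ‖f x‖ ^ 2) : ℝ) : 𝕜) *
      ((c - √(c ^ 2 - ‖f x‖ ^ 2) : ℝ) : 𝕜) = (2 * c : 𝕜) * ((c - √(c ^ 2 - ‖f x‖ ^ 2) : ℝ) : 𝕜)
    have h1 : star (f x) * f x = ((‖f x‖ ^ 2 : ℝ) : 𝕜) := by
      rw [RCLike.star_def, RCLike.conj_mul]; push_cast; rfl
    have h2 : √(c ^ 2 - ‖f x‖ ^ 2) ^ 2 = c ^ 2 - ‖f x‖ ^ 2 := by
      apply Real.sq_sqrt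
      have := hfc x
      nlinarith [norm_nonneg (f x)]
    rw [h1]
    have h3 : ‖f x‖ ^ 2 + (c - √(c ^ 2 - ‖f x‖ ^ 2)) * (c - √(c ^ 2 - ‖f x‖ ^ 2))
        = 2 * c * (c - √(c ^ 2 - ‖f x‖ ^ 2)) := by nlinarith
    exact_mod_cast congrArg (fun t : ℝ => (t : 𝕜)) h3
  have hop : star (ρ f) * ρ f + star (ρ h) * ρ h = (2 * c : 𝕜) • ρ h := by
    rw [← map_star, ← map_star, hstar, ← map_mul, ← map_mul, ← map_add, hid, map_smul]
  refine ContinuousLinearMap.opNorm_le_bound _ (norm_nonneg f) fun v => ?_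
  have h4 := congrArg (fun A : H →L[𝕜] H => RCLike.re (inner 𝕜 (A v) v)) hop
  simp only [add_apply, mul_apply_eq_comp,
    ContinuousLinearMap.star_eq_adjoint, inner_add_left, ContinuousLinearMap.adjoint_inner_left,
    map_add, inner_self_eq_norm_sq, smul_apply] at h4
  have h5 : ‖(c : 𝕜) • v - ρ h v‖ ^ 2
      = c ^ 2 * ‖v‖ ^ 2 - 2 * c * RCLike.re (inner 𝕜 (ρ h v) v) + ‖ρ h v‖ ^ 2 := by
    rw [norm_sub_sq (𝕜 := 𝕜), norm_smul, RCLike.norm_ofReal, inner_smul_left, RCLike.conj_ofReal,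
      RCLike.re_ofReal_mul, inner_re_symm, mul_pow, sq_abs]
    ring
  have h6 : RCLike.re (inner 𝕜 ((2 * c : 𝕜) • ρ h v) v)
      = 2 * c * RCLike.re (inner 𝕜 (ρ h v) v) := by
    have : (2 * c : 𝕜) = ((2 * c : ℝ) : 𝕜) := by push_cast; rfl
    rw [this, inner_smul_left, RCLike.conj_ofReal, RCLike.re_ofReal_mul]
  rw [h6] at h4
  have h7 : ‖ρ f v‖ ^ 2 ≤ (c * ‖v‖) ^ 2 := by
    nlinarith [sq_nonneg ‖(c : 𝕜) • v - ρ h v‖]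
  exact le_of_sq_le_sq h7 (by positivity)

/-- The adjoint of a compact operator on a Hilbert space is compact. -/
lemma isCompactOperator_star {T : H →L[𝕜] H} (hT : IsCompactOperator T) :
    IsCompactOperator (star T : H →L[𝕜] H) := by
  have hTT : IsCompactOperator (T * star T) := hT.comp_clm (star T)
  rw [ContinuousLinearMap.star_eq_adjoint] at hTT ⊢
  have h1 := (isCompactOperator_iff_isCompact_closure_image_closedBall
    ((T * ContinuousLinearMap.adjoint T : H →L[𝕜] H) : H →ₗ[𝕜] H) one_pos).1 hTT
  refine (isCompactOperator_iff_isCompact_closure_image_closedBall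
    ((ContinuousLinearMap.adjoint T : H →L[𝕜] H) : H →ₗ[𝕜] H) one_pos).2 ?_
  refine TotallyBounded.isCompact_of_isClosed (TotallyBounded.closure ?_) isClosed_closure
  have h2 := h1.totallyBounded.subset subset_closure
  rw [Metric.totallyBounded_iff]
  intro ε hε
  obtain ⟨t, hts, htf, hcov⟩ := totallyBounded_iff_subset.1 h2 _
    (Metric.dist_mem_uniformity (show 0 < ε ^ 2 / 4 by positivity))
  obtain ⟨s, hs, hsf, rfl⟩ : ∃ s ⊆ Metric.closedBall (0 : H) 1, s.Finite ∧
      (T * ContinuousLinearMap.adjoint T : H →L[𝕜] H) '' s = t := by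
    obtain ⟨s, hs, hsf, hst⟩ := Set.exists_subset_image_finite_and.1 ⟨t, hts, htf, rfl⟩
    exact ⟨s, hs, hsf, Eq.symm hst⟩
  refine ⟨ContinuousLinearMap.adjoint T '' s, hsf.image _, ?_⟩
  rintro _ ⟨y, hy, rfl⟩
  obtain ⟨_, ⟨z, hz, rfl⟩, hyz⟩ := Set.mem_iUnion₂.1 (hcov ⟨y, hy, rfl⟩)
  refine Set.mem_iUnion₂.2 ⟨_, ⟨z, hz, rfl⟩, ?_⟩
  have hz1 : ‖z‖ ≤ 1 := by simpa using hs hz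
  have hy1 : ‖y‖ ≤ 1 := by simpa using hy
  have h3 : ‖T (ContinuousLinearMap.adjoint T (y - z))‖ < ε ^ 2 / 4 := by
    have : dist (T (ContinuousLinearMap.adjoint T y)) (T (ContinuousLinearMap.adjoint T z))
        < ε ^ 2 / 4 := hyz
    rwa [dist_eq_norm, ← map_sub, ← map_sub] at this
  have h4 : ‖ContinuousLinearMap.adjoint T (y - z)‖ ^ 2 ≤ ε ^ 2 / 4 * 2 := by
    rw [← inner_self_eq_norm_sq (𝕜 := 𝕜), ContinuousLinearMap.adjoint_inner_left]
    calc RCLike.re (inner 𝕜 (y - z) (T (ContinuousLinearMap.adjoint T (y - z))))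
        ≤ ‖y - z‖ * ‖T (ContinuousLinearMap.adjoint T (y - z))‖ := re_inner_le_norm _ _
      _ ≤ 2 * (ε ^ 2 / 4) := by
          gcongr
          exact (norm_sub_le y z).trans (by linarith)
      _ = ε ^ 2 / 4 * 2 := by ring
  change dist (ContinuousLinearMap.adjoint T y) (ContinuousLinearMap.adjoint T z) < ε
  rw [dist_eq_norm, ← map_sub]
  nlinarith [norm_nonneg (ContinuousLinearMap.adjoint T (y - z))]

variable {ρ : C₀(X, 𝕜) →⋆ₙₐ[𝕜] (H →L[𝕜] H)}

lemma IsLocallyCompact.zero : IsLocallyCompact ρ 0 := fun f => by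
  simpa using (isCompactOperator_zero : IsCompactOperator (0 : H → H))

lemma IsLocallyCompact.add {S T : H →L[𝕜] H} (hS : IsLocallyCompact ρ S)
    (hT : IsLocallyCompact ρ T) : IsLocallyCompact ρ (S + T) := fun f => by
  rw [mul_add, add_mul]
  exact ⟨(hS f).1.add (hT f).1, (hS f).2.add (hT f).2⟩

lemma IsLocallyCompact.smul (c : 𝕜) {T : H →L[𝕜] H} (hT : IsLocallyCompact ρ T) :
    IsLocallyCompact ρ (c • T) := fun f => by
  rw [mul_smul_comm, smul_mul_assoc]
  exact ⟨(hT f).1.smul c, (hT f).2.smul c⟩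

lemma IsLocallyCompact.mul {S T : H →L[𝕜] H} (hS : IsLocallyCompact ρ S)
    (hT : IsLocallyCompact ρ T) : IsLocallyCompact ρ (S * T) := fun f => by
  rw [← mul_assoc, mul_assoc S]
  exact ⟨(hS f).1.comp_clm T, (hT f).2.clm_comp S⟩

lemma IsLocallyCompact.star {T : H →L[𝕜] H} (hT : IsLocallyCompact ρ T) :
    IsLocallyCompact ρ (star T) := fun f => by
  have h1 := isCompactOperator_star (hT (Star.star f)).2
  have h2 := isCompactOperator_star (hT (Star.star f)).1
  rw [star_mul, ← map_star, star_star] at h1 h2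
  exact ⟨h1, h2⟩

lemma notMem_operatorSupport {T : H →L[𝕜] H} {x y : X} :
    (x, y) ∉ operatorSupport ρ T ↔ ∃ U ∈ 𝓝 x, ∃ V ∈ 𝓝 y, ∀ f g : C₀(X, 𝕜),
      (∀ z ∉ U, f z = 0) → (∀ z ∉ V, g z = 0) → ρ f * T * ρ g = 0 := by
  rw [operatorSupport, Set.notMem_compl_iff]
  rfl

lemma IsControlled.zero : IsControlled ρ (0 : H →L[𝕜] H) :=
  ⟨1, one_pos, fun x y h => absurd h <| notMem_operatorSupport.2
    ⟨Set.univ, Filter.univ_mem, Set.univ, Filter.univ_mem, by simp⟩⟩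

lemma IsControlled.add {S T : H →L[𝕜] H} (hS : IsControlled ρ S) (hT : IsControlled ρ T) :
    IsControlled ρ (S + T) := by
  obtain ⟨R₁, hR₁, h₁⟩ := hS
  obtain ⟨R₂, hR₂, h₂⟩ := hT
  refine ⟨max R₁ R₂, lt_max_of_lt_left hR₁, fun x y h => ?_⟩
  by_contra! hlt
  obtain ⟨U, hU, V, hV, hUV⟩ := notMem_operatorSupport.1
    fun hm => (h₁ x y hm).not_gt ((le_max_left _ _).trans_lt hlt)
  obtain ⟨U', hU', V', hV', hUV'⟩ := notMem_operatorSupport.1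
    fun hm => (h₂ x y hm).not_gt ((le_max_right _ _).trans_lt hlt)
  refine notMem_operatorSupport.2 ⟨U ∩ U', Filter.inter_mem hU hU', V ∩ V',
    Filter.inter_mem hV hV', fun f g hf hg => ?_⟩ h
  rw [mul_add, add_mul, hUV f g (fun z hz => hf z fun h => hz h.1) (fun z hz => hg z fun h => hz h.1),
    hUV' f g (fun z hz => hf z fun h => hz h.2) (fun z hz => hg z fun h => hz h.2), add_zero]

lemma IsControlled.smul (c : 𝕜) {T : H →L[𝕜] H} (hT : IsControlled ρ T) :
    IsControlled ρ (c • T) := by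
  obtain ⟨R, hR, h₁⟩ := hT
  refine ⟨R, hR, fun x y h => h₁ x y ?_⟩
  by_contra hn
  obtain ⟨U, hU, V, hV, hUV⟩ := notMem_operatorSupport.1 hn
  refine notMem_operatorSupport.2 ⟨U, hU, V, hV, fun f g hf hg => ?_⟩ h
  rw [mul_smul_comm, smul_mul_assoc, hUV f g hf hg, smul_zero]

lemma IsControlled.star {T : H →L[𝕜] H} (hT : IsControlled ρ T) : IsControlled ρ (star T) := by
  obtain ⟨R, hR, h₁⟩ := hT
  refine ⟨R, hR, fun x y h => ?_⟩
  rw [dist_comm]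
  refine h₁ y x ?_
  by_contra hn
  obtain ⟨U, hU, V, hV, hUV⟩ := notMem_operatorSupport.1 hn
  refine notMem_operatorSupport.2 ⟨V, hV, U, hU, fun f g hf hg => ?_⟩ h
  have := congrArg Star.star (hUV (Star.star g) (Star.star f)
    (fun z hz => by simp [hg z hz]) (fun z hz => by simp [hf z hz]))
  simpa [← map_star, mul_assoc] using this

variable [ProperSpace X]

/-- If `T` is `R`-controlled, then `ρ(f) T ρ(g)` vanishes once `f` and `g` live on compact sets at
pointwise distance larger than `R`. -/
lemma mul_mul_eq_zero_of_isCompact {T : H →L[𝕜] H} {R : ℝ}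
    (hT : ∀ x y, (x, y) ∈ operatorSupport ρ T → dist x y ≤ R) {K L : Set X} (hK : IsCompact K)
    (hL : IsCompact L) (hKL : ∀ a ∈ K, ∀ b ∈ L, R < dist a b) (f g : C₀(X, 𝕜))
    (hf : ∀ z ∉ K, f z = 0) (hg : ∀ z ∉ L, g z = 0) : ρ f * T * ρ g = 0 := by
  refine local_induction (P := fun g => ρ f * T * ρ g = 0) (by simp)
    (fun g₁ g₂ h₁ h₂ => by rw [map_add, mul_add, h₁, h₂, add_zero]) hL (fun b hb => ?_) g hg
  refine local_induction (P := fun f => ∃ U ∈ 𝓝 b, ∀ g : C₀(X, 𝕜), (∀ z ∉ U, g z = 0) →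
    ρ f * T * ρ g = 0) ⟨Set.univ, Filter.univ_mem, by simp⟩ ?_ hK (fun a ha => ?_) f hf
  · rintro f₁ f₂ ⟨U₁, hU₁, h₁⟩ ⟨U₂, hU₂, h₂⟩
    refine ⟨U₁ ∩ U₂, Filter.inter_mem hU₁ hU₂, fun g hg => ?_⟩
    rw [map_add, add_mul, add_mul, h₁ g fun z hz => hg z fun h => hz h.1,
      h₂ g fun z hz => hg z fun h => hz h.2, add_zero]
  · obtain ⟨U, hU, V, hV, hUV⟩ := notMem_operatorSupport.1
      fun hm => (hT a b hm).not_gt (hKL a ha b hb)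
    exact ⟨U, hU, fun f hf => ⟨V, hV, fun g hg => hUV f g hf hg⟩⟩

/-- The same statement when only `f` has compact support. -/
lemma mul_mul_eq_zero_of_isClosed {T : H →L[𝕜] H} {R : ℝ}
    (hT : ∀ x y, (x, y) ∈ operatorSupport ρ T → dist x y ≤ R) {K L : Set X} (hK : IsCompact K)
    (hL : IsClosed L) (hKL : ∀ a ∈ K, ∀ b ∈ L, R < dist a b) (f g : C₀(X, 𝕜))
    (hf : ∀ z ∉ K, f z = 0) (hg : ∀ z ∉ L, g z = 0) : ρ f * T * ρ g = 0 := by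
  rw [← norm_eq_zero]
  refine le_antisymm (le_of_forall_pos_le_add fun ε hε => ?_) (norm_nonneg _)
  obtain ⟨χ, hχ, hle⟩ := exists_bump_approx g (ε := ε / (‖ρ f * T‖ + 1)) (by positivity)
  have h0 : ρ f * T * ρ (bump χ hχ * g) = 0 := by
    refine mul_mul_eq_zero_of_isCompact hT hK (IsCompact.inter_left hχ hL)
      (fun a ha b hb => hKL a ha b hb.1) f _ hf fun z hz => ?_
    by_cases hzL : z ∈ L
    · have : χ z = 0 := image_eq_zero_of_notMem_tsupport fun h => hz ⟨hzL, h⟩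
      simp [bump_apply, this]
    · simp [hg z hzL]
  have h1 : ρ f * T * ρ g = ρ f * T * ρ (g - bump χ hχ * g) := by
    rw [map_sub, mul_sub, h0, sub_zero]
  rw [h1, zero_add]
  calc ‖ρ f * T * ρ (g - bump χ hχ * g)‖ ≤ ‖ρ f * T‖ * ‖ρ (g - bump χ hχ * g)‖ := norm_mul_le _ _
    _ ≤ (‖ρ f * T‖ + 1) * (ε / (‖ρ f * T‖ + 1)) := by
        gcongr
        · linarith
        · exact (norm_rep_le ρ _).trans hle
    _ = ε := by field_simp

lemma IsControlled.mul (hρ : IsNondegenerate ρ) {S T : H →L[𝕜] H} (hS : IsControlled ρ S)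
    (hT : IsControlled ρ T) : IsControlled ρ (S * T) := by
  obtain ⟨R₁, hR₁, h₁⟩ := hS
  obtain ⟨R₂, hR₂, h₂⟩ := hT
  refine ⟨R₁ + R₂, by positivity, fun x y h => ?_⟩
  by_contra! hlt
  obtain ⟨ε, hε, hεd⟩ : ∃ ε > 0, R₁ + R₂ + 4 * ε = dist x y :=
    ⟨(dist x y - (R₁ + R₂)) / 4, by linarith, by ring⟩
  refine notMem_operatorSupport.2 ⟨Metric.closedBall x ε, Metric.closedBall_mem_nhds x hε,
    Metric.closedBall y ε, Metric.closedBall_mem_nhds y hε, fun f g hf hg => ?_⟩ h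
  obtain ⟨χ, hχ1, hχ0, hχc, -⟩ := exists_continuous_one_zero_of_isCompact
    (isCompact_closedBall x (R₁ + 2 * ε))
    (t := {b | R₁ + 5 / 2 * ε ≤ dist b x})
    (isClosed_le continuous_const (by fun_prop)) (by
      rw [Set.disjoint_left]
      intro b hb hb'
      simp only [Metric.mem_closedBall, Set.mem_ofPred_eq] at hb hb'
      linarith)
  have hA : ρ (bump χ hχc) * T * ρ g = 0 := by
    refine mul_mul_eq_zero_of_isCompact h₂ (isCompact_closedBall x (R₁ + 5 / 2 * ε))
      (isCompact_closedBall y ε) (fun a ha b hb => ?_) _ _ (fun z hz => ?_) hg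
    · rw [Metric.mem_closedBall] at ha hb
      have t1 := dist_triangle x a y
      have t2 := dist_triangle a b y
      rw [dist_comm x a] at t1
      linarith
    · have : χ z = 0 := hχ0 (by
        simp only [Metric.mem_closedBall, not_le] at hz
        exact hz.le)
      simp [bump_apply, this]
  have hB : ρ f * S = ρ f * S * ρ (bump χ hχc) := by
    refine ContinuousLinearMap.ext_on
      (Submodule.dense_iff_topologicalClosure_eq_top.2 hρ) ?_
    rintro _ ⟨k, w, rfl⟩
    have h3 : ρ f * S * ρ (k - bump χ hχc * k) = 0 := by
      refine mul_mul_eq_zero_of_isClosed h₁ (isCompact_closedBall x ε)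
        (L := {b | R₁ + 2 * ε ≤ dist b x}) (isClosed_le continuous_const (by fun_prop))
        (fun a ha b hb => ?_) _ _ hf fun z hz => ?_
      · rw [Metric.mem_closedBall] at ha
        rw [Set.mem_ofPred_eq] at hb
        have t1 := dist_triangle b a x
        rw [dist_comm b a] at t1
        linarith
      · have : χ z = 1 := hχ1 (by
          simp only [Set.mem_ofPred_eq, not_le] at hz
          exact hz.le)
        simp [bump_apply, this]
    rw [map_sub, mul_sub, map_mul, sub_eq_zero, ← mul_assoc] at h3
    exact congrArg (fun A : H →L[𝕜] H => A w) h3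
  rw [← mul_assoc, hB, mul_assoc _ T, mul_assoc _ (ρ (bump χ hχc)), ← mul_assoc (ρ (bump χ hχc)), hA,
    mul_zero]

/-- The `*`-algebra of locally compact, controlled operators. -/
def locallyCompactControlled (ρ : C₀(X, 𝕜) →⋆ₙₐ[𝕜] (H →L[𝕜] H)) (hρ : IsNondegenerate ρ) :
    NonUnitalStarSubalgebra 𝕜 (H →L[𝕜] H) where
  carrier := {T | IsLocallyCompact ρ T ∧ IsControlled ρ T}
  zero_mem' := ⟨.zero, .zero⟩
  add_mem' hS hT := ⟨hS.1.add hT.1, hS.2.add hT.2⟩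
  mul_mem' hS hT := ⟨hS.1.mul hT.1, hS.2.mul hρ hT.2⟩
  smul_mem' c _ hT := ⟨hT.1.smul c, hT.2.smul c⟩
  star_mem' hT := ⟨hT.1.star, hT.2.star⟩

/-- The Roe `C*`-algebra of `X` with respect to `ρ`: the norm closure in `B(H)` of the `*`-algebra
of locally compact, controlled operators. -/
def roeAlgebra (ρ : C₀(X, 𝕜) →⋆ₙₐ[𝕜] (H →L[𝕜] H)) (hρ : IsNondegenerate ρ) :
    NonUnitalStarSubalgebra 𝕜 (H →L[𝕜] H) :=
  (locallyCompactControlled ρ hρ).topologicalClosure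

end Representation

end CoarseRoe

end

/-! Choose a separated net in `X` so coarse that the coarse equivalence carries it to a separated
net in `Y`. Both nets then have the same index set `A`, and distances in either one are bounded in
terms of distances in the other.

The heart of the argument is `exists_isLocalized`: an ample representation admits a Hilbert basis
indexed by `A × ℕ` whose vectors of index `(i, n)` are supported within a fixed distance of the
`i`-th net point. Cover the space by uniformly bounded open sets, one for each net point, and apply
transfinite Gram-Schmidt to the subspaces they generate. Supports do not grow, because these
subspaces are invariant under the representation. Each open set contains a ball that the others do
not meet, so ampleness makes every orthogonalized piece infinite-dimensional, and separability gives
it a basis indexed by `ℕ`.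

In such a basis, controlled operators are those whose matrix is banded with respect to the distances
of net points (`IsLocalized.isControlled_iff`), and locally compact operators are those that are
compact on each block together with their adjoints (`IsLocalized.isLocallyCompact_iff`). Neither
condition mentions functions any more, and the change of metric between the nets preserves both. So
the unitary that matches the two bases conjugates one `*`-algebra onto the other and, by continuity,
one Roe algebra onto the other. -/

namespace CoarseRoe

/-! ### Separated nets in metric spaces -/

section Nets

variable {X : Type*} [MetricSpace X]

/-- Every metric space contains an `R`-separated, `R`-dense subset. -/
lemma exists_separated_net (R : ℝ) (hR : 0 < R) :
    ∃ A : Set X, (A.Pairwise fun a b => R < dist a b) ∧ ∀ x, ∃ a ∈ A, dist x a ≤ R := by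
  obtain ⟨A, hA⟩ := zorn_subset {A : Set X | A.Pairwise fun a b => R < dist a b}
    fun c hc hchain => ⟨⋃₀ c, (Set.pairwise_sUnion hchain.directedOn).2 hc,
      fun _ => Set.subset_sUnion_of_mem⟩
  refine ⟨A, hA.prop, fun x => ?_⟩
  by_contra! h
  have hx : x ∉ A := fun hx => by
    have := h x hx
    rw [dist_self] at this
    exact this.not_gt hR
  refine hx (hA.le_of_ge (y := insert x A) ?_ (Set.subset_insert x A) (Set.mem_insert x A))
  exact hA.prop.insert fun b hb _ => ⟨h b hb, by rw [dist_comm]; exact h b hb⟩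

/-- A separated family in a proper metric space is locally finite. -/
lemma finite_setOf_dist_le [ProperSpace X] {ι : Type*} {x : ι → X} {s : ℝ} (hs : 0 < s)
    (hsep : Pairwise fun i j => s ≤ dist (x i) (x j)) (c : X) (r : ℝ) :
    {i | dist (x i) c ≤ r}.Finite := by
  obtain ⟨t, -, htf, ht⟩ := (isCompact_closedBall c r).finite_cover_balls (half_pos hs)
  have h : ∀ i ∈ {i | dist (x i) c ≤ r}, ∃ y ∈ t, dist (x i) y < s / 2 := fun i hi => by
    simpa using ht (Metric.mem_closedBall.2 hi)
  have : Nonempty X := ⟨c⟩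
  choose! φ hφt hφ using h
  -- Two members of the family in one ball of radius `s / 2` would be less than `s` apart.
  refine Set.Finite.of_injOn (f := φ) hφt (fun i hi j hj hij => ?_) htf
  by_contra hne
  have h1 := hφ i hi
  have h2 := hφ j hj
  have h3 := hsep hne
  have h4 := dist_triangle_right (x i) (x j) (φ i)
  rw [← hij] at h2
  linarith

end Nets

/-! ### Hilbert bases and Gram-Schmidt for subspaces -/

section HilbertSpace

variable {𝕜 : Type*} [RCLike 𝕜] {H : Type*} [NormedAddCommGroup H] [InnerProductSpace 𝕜 H]

/-- An orthonormal family in a separable space is countable. -/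
lemma _root_.Orthonormal.countable [TopologicalSpace.SeparableSpace H] {ι : Type*} {v : ι → H}
    (hv : Orthonormal 𝕜 v) : Countable ι := by
  refine Pairwise.countable_of_isOpen_disjoint (s := fun i => Metric.ball (v i) (1 / 2))
    (fun i j hij => ?_) (fun i => Metric.isOpen_ball) fun i => ⟨v i, by simp⟩
  refine Metric.ball_disjoint_ball ?_
  -- Distinct vectors are `√2` apart, so balls of radius `1 / 2` around them are disjoint.
  have h : ‖v i - v j‖ ^ 2 = 2 := by
    rw [norm_sub_sq (𝕜 := 𝕜), hv.2 hij, hv.1 i, hv.1 j]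
    norm_num
  rw [dist_eq_norm]
  nlinarith [norm_nonneg (v i - v j)]

/-- An infinite-dimensional separable Hilbert space has a Hilbert basis indexed by `ℕ`. -/
lemma exists_hilbertBasis_nat [CompleteSpace H] [TopologicalSpace.SeparableSpace H]
    (hH : ¬ FiniteDimensional 𝕜 H) : Nonempty (HilbertBasis ℕ 𝕜 H) := by
  obtain ⟨w, b, -⟩ := exists_hilbertBasis 𝕜 H
  have := b.orthonormal.countable
  have : Infinite w := by
    by_contra hw
    rw [not_infinite_iff_finite] at hw
    have := Fintype.ofFinite w
    exact hH b.toOrthonormalBasis.toBasis.finiteDimensional_of_finite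
  obtain ⟨e⟩ := nonempty_equiv_of_countable (α := ℕ) (β := w)
  refine ⟨HilbertBasis.mk (b.orthonormal.comp e e.injective) ?_⟩
  rw [Set.range_comp, e.surjective.range_eq, Set.image_univ, b.dense_span]

/-- An operator whose range lies in a finite-dimensional subspace is compact. -/
lemma isCompactOperator_of_mem {D : Submodule 𝕜 H} [FiniteDimensional 𝕜 D] {T : H →L[𝕜] H}
    (hT : ∀ v, T v ∈ D) : IsCompactOperator T := by
  have := FiniteDimensional.proper 𝕜 D
  have h1 : IsCompactOperator (id : D → D) := (isCompactOperator_id_iff_finiteDimensional (𝕜 := 𝕜)).2 ‹_›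
  exact (h1.comp_clm (T.codRestrict D hT)).clm_comp D.subtypeL

variable {ι : Type*} [LinearOrder ι] (E : ι → Submodule 𝕜 H)

/-- The closed span of the subspaces with index below `i`. -/
def spanBelow (i : ι) : Submodule 𝕜 H := (⨆ j < i, E j).topologicalClosure

/-- Gram-Schmidt orthogonalization of a family of subspaces: the part of `E i` orthogonal to the
subspaces with index below `i`. -/
def orthoPart (i : ι) : Submodule 𝕜 H :=
  (spanBelow E i ⊔ E i).topologicalClosure ⊓ (spanBelow E i)ᗮ

lemma isClosed_spanBelow (i : ι) : IsClosed (spanBelow E i : Set H) :=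
  Submodule.isClosed_topologicalClosure _

lemma le_spanBelow {i j : ι} (h : i < j) : E i ≤ spanBelow E j :=
  (le_iSup₂ (f := fun k (_ : k < j) => E k) i h).trans (Submodule.le_topologicalClosure _)

lemma isClosed_orthoPart (i : ι) : IsClosed (orthoPart E i : Set H) :=
  (Submodule.isClosed_topologicalClosure _).inter (Submodule.isClosed_orthogonal _)

lemma orthoPart_le_spanBelow {i j : ι} (h : i < j) : orthoPart E i ≤ spanBelow E j := by
  refine inf_le_left.trans (Submodule.topologicalClosure_minimal _ (sup_le ?_ (le_spanBelow E h))
    (isClosed_spanBelow E j))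
  exact Submodule.topologicalClosure_mono (iSup₂_le fun k hk => le_iSup₂_of_le k (hk.trans h) le_rfl)

lemma orthoPart_isOrtho {i j : ι} (h : i < j) : orthoPart E i ⟂ orthoPart E j :=
  (Submodule.isOrtho_orthogonal_right _).mono (orthoPart_le_spanBelow E h) inf_le_right

lemma orthogonalFamily_orthoPart :
    OrthogonalFamily 𝕜 (fun i => orthoPart E i) fun i => (orthoPart E i).subtypeₗᵢ := by
  refine OrthogonalFamily.of_pairwise fun i j hij => ?_
  rcases hij.lt_or_gt with h | h
  · exact orthoPart_isOrtho E h
  · exact (orthoPart_isOrtho E h).symm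

/-- Well-founded induction: a vector of `E i` splits into its projection to `spanBelow E i`, which
the induction hypothesis covers, and a remainder lying in `orthoPart E i`. -/
lemma le_closure_iSup_orthoPart [CompleteSpace H] [WellFoundedLT ι] (i : ι) :
    E i ≤ (⨆ j, orthoPart E j).topologicalClosure := by
  induction i using WellFoundedLT.induction with
  | ind i ih =>
    have hK : spanBelow E i ≤ (⨆ j, orthoPart E j).topologicalClosure :=
      Submodule.topologicalClosure_minimal _ (iSup₂_le ih) (Submodule.isClosed_topologicalClosure _)
    intro e he
    have : CompleteSpace (spanBelow E i) := (isClosed_spanBelow E i).completeSpace_coe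
    have h1 : (spanBelow E i).starProjection e ∈ spanBelow E i :=
      Submodule.starProjection_apply_mem _ _
    rw [← sub_add_cancel e ((spanBelow E i).starProjection e)]
    refine add_mem (Submodule.le_topologicalClosure _ (Submodule.mem_iSup_of_mem i ⟨?_, ?_⟩))
      (hK h1)
    · exact Submodule.le_topologicalClosure _
        (sub_mem (Submodule.mem_sup_right he) (Submodule.mem_sup_left h1))
    · exact Submodule.sub_starProjection_mem_orthogonal _

/-- Hilbert bases of the summands of an orthogonal decomposition combine to a Hilbert basis. -/
lemma exists_hilbertBasis_prod_nat {κ : Type*} [CompleteSpace H]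
    [TopologicalSpace.SeparableSpace H] {D : κ → Submodule 𝕜 H}
    (hclosed : ∀ i, IsClosed (D i : Set H)) (hinf : ∀ i, ¬ FiniteDimensional 𝕜 (D i))
    (hortho : OrthogonalFamily 𝕜 (fun i => D i) fun i => (D i).subtypeₗᵢ)
    (hdense : (⨆ i, D i).topologicalClosure = ⊤) :
    ∃ b : HilbertBasis (κ × ℕ) 𝕜 H, ∀ i n, b (i, n) ∈ D i := by
  have (i : κ) : CompleteSpace (D i) := (hclosed i).completeSpace_coe
  let c (i : κ) : HilbertBasis ℕ 𝕜 (D i) := (exists_hilbertBasis_nat (hinf i)).some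
  have ho : Orthonormal 𝕜 fun p : κ × ℕ => (c p.1 p.2 : H) :=
    (hortho.orthonormal_sigma_orthonormal fun i => (c i).orthonormal).comp
      (Equiv.sigmaEquivProd κ ℕ).symm (Equiv.injective _)
  refine ⟨HilbertBasis.mk ho ?_, fun i n => ?_⟩
  · rw [← hdense]
    refine Submodule.topologicalClosure_minimal _ (iSup_le fun i v hv => ?_)
      (Submodule.isClosed_topologicalClosure _)
    have h1 : (⟨v, hv⟩ : D i) ∈ (Submodule.span 𝕜 (Set.range (c i))).topologicalClosure := by
      rw [(c i).dense_span]; trivial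
    have h2 : (Submodule.span 𝕜 (Set.range (c i))).topologicalClosure ≤
        (Submodule.span 𝕜 (Set.range fun p : κ × ℕ => (c p.1 p.2 : H))).topologicalClosure.comap
          (D i).subtype := by
      refine Submodule.topologicalClosure_minimal _ (Submodule.span_le.2 ?_)
        ((Submodule.isClosed_topologicalClosure _).preimage continuous_subtype_val)
      rintro _ ⟨n, rfl⟩
      exact Submodule.le_topologicalClosure _ (Submodule.subset_span ⟨(i, n), rfl⟩)
    exact h2 h1
  · rw [HilbertBasis.coe_mk]
    exact (c i n).2

end HilbertSpace

/-! ### Bases localized near a net -/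

section LocalizedBasis

variable {𝕜 : Type*} [RCLike 𝕜] {X : Type*} [MetricSpace X]
  {H : Type*} [NormedAddCommGroup H] [InnerProductSpace 𝕜 H] [CompleteSpace H]
  {ρ : C₀(X, 𝕜) →⋆ₙₐ[𝕜] (H →L[𝕜] H)}

lemma rep_mul_apply (f g : C₀(X, 𝕜)) (v : H) : ρ f (ρ g v) = ρ (f * g) v := by
  rw [map_mul]; rfl

lemma inner_rep_left (f : C₀(X, 𝕜)) (v w : H) :
    inner 𝕜 (ρ f v) w = inner 𝕜 v (ρ (star f) w) := by
  rw [map_star, ContinuousLinearMap.star_eq_adjoint, ContinuousLinearMap.adjoint_inner_right]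

lemma inner_rep_right (f : C₀(X, 𝕜)) (v w : H) :
    inner 𝕜 v (ρ f w) = inner 𝕜 (ρ (star f) v) w := by
  rw [inner_rep_left, star_star]

variable (ρ) in
/-- The span of the vectors `ρ(f)v` with `f` vanishing outside `U`. -/
def spanOn (U : Set X) : Submodule 𝕜 H :=
  Submodule.span 𝕜 {w | ∃ (f : C₀(X, 𝕜)) (v : H), (∀ z ∉ U, f z = 0) ∧ ρ f v = w}

lemma rep_apply_mem_spanOn {U : Set X} {f : C₀(X, 𝕜)} (hf : ∀ z ∉ U, f z = 0) (v : H) :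
    ρ f v ∈ spanOn ρ U :=
  Submodule.subset_span ⟨f, v, hf, rfl⟩

lemma spanOn_le_comap (U : Set X) (f : C₀(X, 𝕜)) :
    spanOn ρ U ≤ (spanOn ρ U).comap (ρ f : H →ₗ[𝕜] H) := by
  refine Submodule.span_le.2 ?_
  rintro _ ⟨g, v, hg, rfl⟩
  change ρ f (ρ g v) ∈ spanOn ρ U
  rw [rep_mul_apply]
  exact rep_apply_mem_spanOn (fun z hz => by simp [hg z hz]) v

lemma rep_apply_eq_zero_of_mem_spanOn {U : Set X} {f : C₀(X, 𝕜)} (hf : ∀ z ∈ U, f z = 0) {v : H}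
    (hv : v ∈ spanOn ρ U) : ρ f v = 0 := by
  suffices h : spanOn ρ U ≤ LinearMap.ker (ρ f : H →ₗ[𝕜] H) from h hv
  refine Submodule.span_le.2 ?_
  rintro _ ⟨g, w, hg, rfl⟩
  change ρ f (ρ g w) = 0
  have : f * g = 0 := by
    ext z
    by_cases hz : z ∈ U
    · simp [hf z hz]
    · simp [hg z hz]
  rw [rep_mul_apply, this, map_zero, zero_apply]

/-- The subspaces belonging to the members of an open cover span a dense subspace. -/
lemma dense_iSup_spanOn [ProperSpace X] (hρ : IsNondegenerate ρ) {ι : Type*} {U : ι → Set X}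
    (hU : ∀ i, IsOpen (U i)) (hcover : ∀ x, ∃ i, x ∈ U i) :
    (⨆ i, spanOn ρ (U i)).topologicalClosure = ⊤ := by
  rw [eq_top_iff, ← hρ]
  refine Submodule.topologicalClosure_minimal _ (Submodule.span_le.2 ?_)
    (Submodule.isClosed_topologicalClosure _)
  rintro _ ⟨f, v, rfl⟩
  change ρ f v ∈ closure ((⨆ i, spanOn ρ (U i) : Submodule 𝕜 H) : Set H)
  rw [Metric.mem_closure_iff]
  intro ε hε
  obtain ⟨χ, hχ, hle⟩ := exists_bump_approx f (ε := ε / 2 / (‖v‖ + 1)) (by positivity)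
  refine ⟨ρ (bump χ hχ * f) v, ?_, ?_⟩
  -- A partition of unity cuts the compactly supported function into pieces, each living in a single
  -- member of the cover.
  · refine local_induction (P := fun g => ρ g v ∈ ⨆ i, spanOn ρ (U i)) (by simp)
      (fun g₁ g₂ h₁ h₂ => ?_) hχ (fun a _ => ?_) _ fun z hz => ?_
    · rw [map_add]
      exact add_mem h₁ h₂
    · obtain ⟨i, hi⟩ := hcover a
      exact ⟨U i, (hU i).mem_nhds hi, fun h hh =>
        Submodule.mem_iSup_of_mem i (rep_apply_mem_spanOn hh v)⟩
    · have : χ z = 0 := image_eq_zero_of_notMem_tsupport hz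
      simp [bump_apply, this]
  · rw [dist_eq_norm, ← sub_apply, ← map_sub]
    calc ‖ρ (f - bump χ hχ * f) v‖ ≤ ‖ρ (f - bump χ hχ * f)‖ * ‖v‖ :=
          ContinuousLinearMap.le_opNorm _ _
      _ ≤ ε / 2 / (‖v‖ + 1) * (‖v‖ + 1) := by
          gcongr
          · exact (norm_rep_le ρ _).trans hle
          · linarith
      _ < ε := by
          rw [div_mul_cancel₀ _ (by positivity)]
          linarith

section Ordered

variable {ι : Type*} [LinearOrder ι] {U : ι → Set X}

/-- Invariance passes to sums and closures. Applied to `star f`, it also shows that the orthogonal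
complement is invariant under `ρ f`. -/
lemma spanBelow_spanOn_le_comap (i : ι) (f : C₀(X, 𝕜)) :
    spanBelow (fun j => spanOn ρ (U j)) i ≤
      (spanBelow (fun j => spanOn ρ (U j)) i).comap (ρ f : H →ₗ[𝕜] H) := by
  refine Submodule.topologicalClosure_minimal _ (iSup₂_le fun j hj e he => ?_)
    ((isClosed_spanBelow _ i).preimage (ρ f).continuous)
  exact le_spanBelow (fun j => spanOn ρ (U j)) hj (spanOn_le_comap (U j) f he)

/-- Vectors in the orthogonalized subspace are still supported in `U i`. -/
lemma rep_apply_eq_zero_of_mem_orthoPart {i : ι} {f : C₀(X, 𝕜)} (hf : ∀ z ∈ U i, f z = 0) {v : H}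
    (hv : v ∈ orthoPart (fun j => spanOn ρ (U j)) i) : ρ f v = 0 := by
  -- Since `ρ f` kills `spanOn ρ (U i)`, it maps everything of index at most `i` into `spanBelow`.
  -- But `v` is orthogonal to `spanBelow`, hence so is `ρ f v`, which must vanish.
  have h1 : (spanBelow (fun j => spanOn ρ (U j)) i ⊔ spanOn ρ (U i)).topologicalClosure ≤
      (spanBelow (fun j => spanOn ρ (U j)) i).comap (ρ f : H →ₗ[𝕜] H) := by
    refine Submodule.topologicalClosure_minimal _ (sup_le (spanBelow_spanOn_le_comap i f)
      fun e he => ?_) ((isClosed_spanBelow _ i).preimage (ρ f).continuous)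
    change ρ f e ∈ spanBelow (fun j => spanOn ρ (U j)) i
    rw [rep_apply_eq_zero_of_mem_spanOn hf he]
    exact zero_mem _
  have h2 : ρ f v ∈ spanBelow (fun j => spanOn ρ (U j)) i := h1 hv.1
  have h3 : ρ f v ∈ (spanBelow (fun j => spanOn ρ (U j)) i)ᗮ := fun u hu => by
    rw [inner_rep_right]
    exact hv.2 _ (spanBelow_spanOn_le_comap i _ hu)
  exact inner_self_eq_zero.1 (h3 _ h2)

/-- The function `star f` annihilates the subspaces of all other indices, so the range of `ρ f` is
orthogonal to them. Bump functions of this kind detect that `orthoPart` is large. -/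
lemma rep_apply_mem_orthoPart {i : ι} {f : C₀(X, 𝕜)} (hf : ∀ z ∉ U i, f z = 0)
    (hf' : ∀ j ≠ i, ∀ z ∈ U j, f z = 0) (v : H) :
    ρ f v ∈ orthoPart (fun j => spanOn ρ (U j)) i := by
  refine ⟨Submodule.le_topologicalClosure _ (Submodule.mem_sup_right (rep_apply_mem_spanOn hf v)),
    ?_⟩
  have h : spanBelow (fun j => spanOn ρ (U j)) i ≤ LinearMap.ker (ρ (star f) : H →ₗ[𝕜] H) := by
    refine Submodule.topologicalClosure_minimal _ (iSup₂_le fun j hj u hu => ?_)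
      (ContinuousLinearMap.isClosed_ker (ρ (star f)))
    exact rep_apply_eq_zero_of_mem_spanOn (fun z hz => by simp [hf' j hj.ne z hz]) hu
  intro u hu
  rw [inner_rep_right]
  have : ρ (star f) u = 0 := h hu
  rw [this, inner_zero_left]

end Ordered

/-- A Hilbert basis is localized near the points `x i` if `b (i, n)` is supported in the closed
ball of radius `r` around `x i`. -/
def IsLocalized {ι : Type*} (ρ : C₀(X, 𝕜) →⋆ₙₐ[𝕜] (H →L[𝕜] H)) (b : HilbertBasis (ι × ℕ) 𝕜 H)
    (x : ι → X) (r : ℝ) : Prop :=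
  ∀ i n, ∀ f : C₀(X, 𝕜), (∀ z ∈ Metric.closedBall (x i) r, f z = 0) → ρ f (b (i, n)) = 0

/-- A separated family in a proper space admits an open cover by uniformly bounded sets such that
each member exclusively contains a ball. -/
lemma exists_open_cover [ProperSpace X] {ι : Type*} {x : ι → X} {s r : ℝ} (hs : 0 < s)
    (hsep : Pairwise fun i j => s ≤ dist (x i) (x j)) (hr : ∀ z, ∃ i, dist z (x i) ≤ r) :
    ∃ U : ι → Set X, (∀ i, IsOpen (U i)) ∧ (∀ z, ∃ i, z ∈ U i) ∧
      (∀ i, U i ⊆ Metric.closedBall (x i) (r + s)) ∧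
      (∀ i, Metric.ball (x i) (s / 3) ⊆ U i) ∧
      ∀ i j, j ≠ i → Disjoint (U j) (Metric.ball (x i) (s / 3)) := by
  have hlf (i : ι) : IsClosed (⋃ j ∈ {j | j ≠ i}, Metric.closedBall (x j) (s / 3)) := by
    have : LocallyFinite fun j : ι => Metric.closedBall (x j) (s / 3) := fun z =>
      ⟨Metric.ball z 1, Metric.ball_mem_nhds z one_pos,
        (finite_setOf_dist_le hs hsep z (1 + s / 3)).subset fun j ⟨w, hw1, hw2⟩ => by
          rw [Metric.mem_closedBall] at hw1
          rw [Metric.mem_ball] at hw2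
          have := dist_triangle_left (x j) z w
          change dist (x j) z ≤ _
          linarith⟩
    rw [Set.biUnion_eq_iUnion]
    exact (this.comp_injective Subtype.val_injective).isClosed_iUnion fun j =>
      Metric.isClosed_closedBall
  have hr0 (i : ι) : 0 ≤ r := by
    obtain ⟨j, hj⟩ := hr (x i)
    exact dist_nonneg.trans hj
  have hdisj (i j : ι) (hij : j ≠ i) (z : X) (h1 : dist z (x i) ≤ s / 3)
      (h2 : dist z (x j) ≤ s / 3) : False := by
    have := dist_triangle_left (x j) (x i) z
    have := hsep hij
    linarith
  -- Removing the balls of radius `s / 3` around the other net points reserves for each point its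
  -- own ball. These closed balls are disjoint because `2 * s / 3 < s`. A point inside a reserved
  -- ball is covered by the owner of that ball, any other point by a nearby net point.
  refine ⟨fun i => Metric.ball (x i) (r + s) \ ⋃ j ∈ {j | j ≠ i}, Metric.closedBall (x j) (s / 3),
    fun i => Metric.isOpen_ball.sdiff (hlf i), fun z => ?_,
    fun i => Set.sdiff_subset.trans Metric.ball_subset_closedBall, fun i z hz => ⟨?_, ?_⟩,
    fun i j hij => ?_⟩
  · by_cases hz : ∃ i, dist z (x i) ≤ s / 3
    · obtain ⟨i, hi⟩ := hz
      refine ⟨i, ?_, ?_⟩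
      · rw [Metric.mem_ball]
        have := hr0 i
        linarith
      · simp only [Set.mem_iUnion, not_exists]
        exact fun j hj hzj => hdisj i j hj z hi hzj
    · push Not at hz
      obtain ⟨i, hi⟩ := hr z
      refine ⟨i, ?_, ?_⟩
      · rw [Metric.mem_ball]
        linarith
      · simp only [Set.mem_iUnion, not_exists]
        exact fun j hj hzj => (hz j).not_ge hzj
  · rw [Metric.mem_ball] at hz ⊢
    have := hr0 i
    linarith
  · simp only [Set.mem_iUnion, not_exists]
    exact fun j hj hzj => hdisj i j hj z (Metric.mem_ball.1 hz).le hzj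
  · rw [Set.disjoint_left]
    intro z hz hz'
    exact hz.2 (Set.mem_iUnion₂.2 ⟨i, hij.symm, Metric.ball_subset_closedBall hz'⟩)

/-- Ample representations admit localized Hilbert bases. -/
theorem exists_isLocalized [ProperSpace X] [TopologicalSpace.SeparableSpace H]
    (hρ : IsNondegenerate ρ) (hample : IsAmple ρ) {ι : Type*} {x : ι → X} {s r : ℝ} (hs : 0 < s)
    (hsep : Pairwise fun i j => s ≤ dist (x i) (x j)) (hr : ∀ z, ∃ i, dist z (x i) ≤ r) :
    ∃ b : HilbertBasis (ι × ℕ) 𝕜 H, IsLocalized ρ b x (r + s) := by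
  obtain ⟨U, hUo, hUc, hUb, hUs, hUd⟩ := exists_open_cover hs hsep hr
  let _ : LinearOrder ι := WellOrderingRel.isWellOrder.linearOrder
  have : WellFoundedLT ι := WellOrderingRel.isWellOrder.toIsWellFounded
  -- A bump function inside the reserved ball at `x i` maps `H` into the `i`-th piece. Were that
  -- piece finite-dimensional, the operator would be compact and ampleness would force the bump to
  -- be zero.
  have hinf (i : ι) : ¬ FiniteDimensional 𝕜 (orthoPart (fun j => spanOn ρ (U j)) i) := by
    intro hfin
    obtain ⟨χ, hχ1, hχ0, hχc, -⟩ := exists_continuous_one_zero_of_isCompact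
      (isCompact_singleton (x := x i)) (t := (Metric.ball (x i) (s / 3))ᶜ)
      Metric.isOpen_ball.isClosed_compl (by simp [hs])
    have h0 := hample (bump χ hχc) (isCompactOperator_of_mem (rep_apply_mem_orthoPart (i := i)
      (fun z hz => by
        have : χ z = 0 := hχ0 fun h => hz (hUs i h)
        simp [bump_apply, this])
      fun j hj z hz => by
        have : χ z = 0 := hχ0 fun h => Set.disjoint_left.1 (hUd i j hj) hz h
        simp [bump_apply, this]))
    have h1 : χ (x i) = 1 := hχ1 rfl
    have h2 : (bump χ hχc : C₀(X, 𝕜)) (x i) = 0 := by rw [h0]; rfl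
    simp [bump_apply, h1] at h2
  obtain ⟨b, hb⟩ := exists_hilbertBasis_prod_nat (isClosed_orthoPart _) hinf
    (orthogonalFamily_orthoPart _) (by
      rw [eq_top_iff, ← dense_iSup_spanOn hρ hUo hUc]
      exact Submodule.topologicalClosure_minimal _ (iSup_le fun i => le_closure_iSup_orthoPart
        (fun j => spanOn ρ (U j)) i) (Submodule.isClosed_topologicalClosure _))
  exact ⟨b, fun i n f hf => rep_apply_eq_zero_of_mem_orthoPart (fun z hz => hf z (hUb i hz))
    (hb i n)⟩

end LocalizedBasis

/-! ### Block projections of a basis -/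

section Blocks

variable {𝕜 : Type*} [RCLike 𝕜] {H : Type*} [NormedAddCommGroup H] [InnerProductSpace 𝕜 H]

/-- Expand `v` in the basis: in each term of the series for `A v`, either the coefficient or the
image of the basis vector vanishes. -/
lemma _root_.HilbertBasis.map_eq_zero {κ : Type*} (b : HilbertBasis κ 𝕜 H) (A : H →L[𝕜] H) {v : H}
    (h : ∀ p, inner 𝕜 (b p) v = 0 ∨ A (b p) = 0) : A v = 0 := by
  have h1 := A.hasSum (b.hasSum_repr v)
  refine h1.unique ?_
  convert hasSum_zero with p
  rw [map_smul, b.repr_apply_apply]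
  rcases h p with h | h <;> simp [h]

lemma _root_.HilbertBasis.clm_ext {κ : Type*} (b : HilbertBasis κ 𝕜 H) {A B : H →L[𝕜] H}
    (h : ∀ p, A (b p) = B (b p)) : A = B :=
  ContinuousLinearMap.ext_on (Submodule.dense_iff_topologicalClosure_eq_top.2 b.dense_span) <| by
    rintro _ ⟨p, rfl⟩
    exact h p

variable [CompleteSpace H] {ι : Type*}

/-- The orthogonal projection onto the closed span of the basis vectors `b (i, n)`. -/
noncomputable def blockProj (b : HilbertBasis (ι × ℕ) 𝕜 H) (i : ι) : H →L[𝕜] H :=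
  have : CompleteSpace (Submodule.span 𝕜 (Set.range fun n => b (i, n))).topologicalClosure :=
    (Submodule.isClosed_topologicalClosure _).completeSpace_coe
  (Submodule.span 𝕜 (Set.range fun n => b (i, n))).topologicalClosure.starProjection

lemma blockProj_apply_self (b : HilbertBasis (ι × ℕ) 𝕜 H) (i : ι) (n : ℕ) :
    blockProj b i (b (i, n)) = b (i, n) := by
  have : CompleteSpace (Submodule.span 𝕜 (Set.range fun n => b (i, n))).topologicalClosure :=
    (Submodule.isClosed_topologicalClosure _).completeSpace_coe
  exact Submodule.starProjection_eq_self_iff.2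
    (Submodule.le_topologicalClosure _ (Submodule.subset_span ⟨n, rfl⟩))

lemma blockProj_apply_of_ne (b : HilbertBasis (ι × ℕ) 𝕜 H) {i j : ι} (h : j ≠ i) (n : ℕ) :
    blockProj b i (b (j, n)) = 0 := by
  have : CompleteSpace (Submodule.span 𝕜 (Set.range fun n => b (i, n))).topologicalClosure :=
    (Submodule.isClosed_topologicalClosure _).completeSpace_coe
  refine (Submodule.starProjection_apply_eq_zero_iff _).2 ?_
  rw [Submodule.orthogonal_closure, Submodule.mem_orthogonal]
  intro u hu
  induction hu using Submodule.span_induction with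
  | mem u hu =>
    obtain ⟨m, rfl⟩ := hu
    exact b.orthonormal.2 fun he => h (congrArg Prod.fst he).symm
  | zero => exact inner_zero_left _
  | add u v _ _ hu hv => rw [inner_add_left, hu, hv, add_zero]
  | smul c u _ hu => rw [inner_smul_left, hu, mul_zero]

lemma star_blockProj (b : HilbertBasis (ι × ℕ) 𝕜 H) (i : ι) :
    star (blockProj b i) = blockProj b i := by
  have : CompleteSpace (Submodule.span 𝕜 (Set.range fun n => b (i, n))).topologicalClosure :=
    (Submodule.isClosed_topologicalClosure _).completeSpace_coe
  exact (isSelfAdjoint_starProjection _).star_eq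

end Blocks

/-! ### Matrix description of controlled and locally compact operators -/

section Localized

variable {𝕜 : Type*} [RCLike 𝕜] {X : Type*} [MetricSpace X]
  {H : Type*} [NormedAddCommGroup H] [InnerProductSpace 𝕜 H] [CompleteSpace H]
  {ρ : C₀(X, 𝕜) →⋆ₙₐ[𝕜] (H →L[𝕜] H)} {ι : Type*} {b : HilbertBasis (ι × ℕ) 𝕜 H} {x : ι → X} {r : ℝ}

/-- Such a `v` is orthogonal to all vectors `ρ f w`, and these span a dense subspace. -/
lemma IsNondegenerate.eq_zero (hρ : IsNondegenerate ρ) {v : H} (hv : ∀ f, ρ f v = 0) : v = 0 := by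
  have h : innerSL 𝕜 v = 0 := by
    refine ContinuousLinearMap.ext_on (Submodule.dense_iff_topologicalClosure_eq_top.2 hρ) ?_
    rintro _ ⟨f, w, rfl⟩
    rw [innerSL_apply_apply, inner_rep_right, hv, inner_zero_left]
    rfl
  exact inner_self_eq_zero.1 (congrArg (fun A => A v) h)

/-- By nondegeneracy it suffices to test the difference against each `ρ f`, and `f * χ - f` vanishes
on the ball supporting the basis vector. -/
lemma IsLocalized.bump_apply (hb : IsLocalized ρ b x r) (hρ : IsNondegenerate ρ) {i : ι}
    {χ : C(X, ℝ)} (hχ : HasCompactSupport χ) (h1 : ∀ z ∈ Metric.closedBall (x i) r, χ z = 1)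
    (n : ℕ) : ρ (bump χ hχ) (b (i, n)) = b (i, n) := by
  rw [← sub_eq_zero]
  refine hρ.eq_zero fun f => ?_
  rw [map_sub, rep_mul_apply, ← sub_apply, ← map_sub]
  refine hb i n _ fun z hz => ?_
  simp [CoarseRoe.bump_apply, h1 z hz]

variable [ProperSpace X]

lemma exists_bump_ball (c : X) (r : ℝ) : ∃ (χ : C(X, ℝ)) (_ : HasCompactSupport χ),
    (∀ z ∈ Metric.closedBall c r, χ z = 1) ∧ ∀ z ∉ Metric.ball c (r + 1), χ z = 0 := by
  obtain ⟨χ, hχ1, hχ0, hχc, -⟩ := exists_continuous_one_zero_of_isCompact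
    (isCompact_closedBall c r) (t := (Metric.ball c (r + 1))ᶜ) Metric.isOpen_ball.isClosed_compl
    (Set.disjoint_compl_right_iff_subset.2 (Metric.closedBall_subset_ball (lt_add_one r)))
  exact ⟨χ, hχc, hχ1, hχ0⟩

/-- The matrix of `T` with respect to `b` is supported near the diagonal. -/
def IsBanded (b : HilbertBasis (ι × ℕ) 𝕜 H) (x : ι → X) (T : H →L[𝕜] H) : Prop :=
  ∃ R : ℝ, ∀ i j n m, R < dist (x i) (x j) → inner 𝕜 (b (i, n)) (T (b (j, m))) = 0

/-- `T` is compact on each block of the basis, and so is its adjoint. -/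
def IsBlockCompact (b : HilbertBasis (ι × ℕ) 𝕜 H) (T : H →L[𝕜] H) : Prop :=
  ∀ i, IsCompactOperator (T * blockProj b i) ∧ IsCompactOperator (star T * blockProj b i)

/-- Basis vectors have supports of radius `r`, and a function of small support kills every basis
vector far from it. So the operator support and the matrix support differ by a bounded amount. -/
lemma IsLocalized.isControlled_iff (hb : IsLocalized ρ b x r) (hρ : IsNondegenerate ρ)
    {T : H →L[𝕜] H} : IsControlled ρ T ↔ IsBanded b x T := by
  constructor
  · rintro ⟨R, hR, hT⟩
    refine ⟨R + 2 * r + 2, fun i j n m hij => ?_⟩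
    obtain ⟨χ, hχ, hχ1, hχ0⟩ := exists_bump_ball (x i) r
    obtain ⟨ψ, hψ, hψ1, hψ0⟩ := exists_bump_ball (x j) r
    have h0 : ρ (star (bump χ hχ)) * T * ρ (bump ψ hψ) = 0 := by
      refine mul_mul_eq_zero_of_isCompact hT (isCompact_closedBall (x i) (r + 1))
        (isCompact_closedBall (x j) (r + 1)) (fun u hu v hv => ?_) _ _ (fun z hz => ?_)
        fun z hz => ?_
      · rw [Metric.mem_closedBall] at hu hv
        have h1 := dist_triangle4_left u v (x i) (x j)
        linarith
      · have := hχ0 z fun h => hz (Metric.ball_subset_closedBall h)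
        simp [CoarseRoe.bump_apply, this]
      · have := hψ0 z fun h => hz (Metric.ball_subset_closedBall h)
        simp [CoarseRoe.bump_apply, this]
    rw [← hb.bump_apply hρ hχ hχ1, ← hb.bump_apply hρ hψ hψ1, inner_rep_left]
    have h1 : ρ (star (bump χ hχ)) (T (ρ (bump ψ hψ) (b (j, m)))) = 0 :=
      congrArg (fun A : H →L[𝕜] H => A (b (j, m))) h0
    rw [h1, inner_zero_right]
  · rintro ⟨R, hT⟩
    -- A basis vector not killed by `f` or `g` has its net point within `r + 1` of `u` or `v`, so
    -- the two ends cost `2 * (r + 1)`. The absolute values keep the bound positive.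
    refine ⟨|R| + 2 * |r| + 3, by positivity, fun u v huv => ?_⟩
    by_contra! hlt
    refine notMem_operatorSupport.2 ⟨Metric.ball u 1, Metric.ball_mem_nhds u one_pos,
      Metric.ball v 1, Metric.ball_mem_nhds v one_pos, fun f g hf hg => ?_⟩ huv
    have hfar (w : X) (k : C₀(X, 𝕜)) (hk : ∀ z ∉ Metric.ball w 1, k z = 0) (i : ι) (n : ℕ)
        (hi : r + 1 ≤ dist (x i) w) : ρ k (b (i, n)) = 0 := by
      refine hb i n k fun z hz => hk z fun hz' => ?_
      rw [Metric.mem_closedBall] at hz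
      rw [Metric.mem_ball] at hz'
      have := dist_triangle_left (x i) w z
      linarith
    ext w
    change (ρ f * T) (ρ g w) = 0
    refine b.map_eq_zero _ fun p => ?_
    by_cases hp : r + 1 ≤ dist (x p.1) v
    · left
      rw [inner_rep_right, hfar v (star g) (fun z hz => by simp [hg z hz]) p.1 p.2 hp,
        inner_zero_left]
    · right
      change ρ f (T (b p)) = 0
      refine b.map_eq_zero _ fun q => ?_
      by_cases hq : r + 1 ≤ dist (x q.1) u
      · exact Or.inr (hfar u f hf q.1 q.2 hq)
      · left
        refine hT q.1 p.1 q.2 p.2 ?_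
        have h1 := dist_triangle4_left (x q.1) (x p.1) u v
        linarith [le_abs_self R, le_abs_self r]

/-- A compactly supported function meets only finitely many blocks, so it yields a finite sum of
operators `T * blockProj b i` times bounded ones. The general case is a norm limit. -/
lemma IsLocalized.isCompactOperator_mul_rep (hb : IsLocalized ρ b x r)
    (hfin : ∀ (c : X) (R : ℝ), {i | dist (x i) c ≤ R}.Finite) {T : H →L[𝕜] H}
    (hT : ∀ i, IsCompactOperator (T * blockProj b i)) (f : C₀(X, 𝕜)) :
    IsCompactOperator (T * ρ f) := by
  rcases isEmpty_or_nonempty X with hX | ⟨⟨c⟩⟩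
  · have : f = 0 := by ext z; exact hX.elim z
    rw [this, map_zero, mul_zero]
    exact isCompactOperator_zero
  have hcpt (χ : C(X, ℝ)) (hχ : HasCompactSupport χ) :
      IsCompactOperator (T * ρ (bump χ hχ * f)) := by
    obtain ⟨R, hR⟩ := (Metric.isBounded_iff_subset_closedBall c).1 hχ.isBounded
    have hR0 : ∀ z, R < dist z c → χ z = 0 := fun z hz =>
      image_eq_zero_of_notMem_tsupport fun h => (Metric.mem_closedBall.1 (hR h)).not_gt hz
    set F := (hfin c (R + r)).toFinset with hF
    -- Localization describes `ρ` on basis vectors, which puts the projections on the right.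
    -- Starting from the adjoint function and taking adjoints in `h2` moves them to the left, next
    -- to `T`.
    have h1 : ρ (star (bump χ hχ * f)) = ∑ i ∈ F, ρ (star (bump χ hχ * f)) * blockProj b i := by
      refine b.clm_ext fun ⟨j, n⟩ => ?_
      rw [sum_apply]
      by_cases hj : j ∈ F
      · rw [Finset.sum_eq_single_of_mem j hj fun i _ hij => ?_]
        · rw [mul_apply_eq_comp, blockProj_apply_self]
        · rw [mul_apply_eq_comp, blockProj_apply_of_ne b hij.symm, map_zero]
      · have h0 : ρ (star (bump χ hχ * f)) (b (j, n)) = 0 := by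
          refine hb j n _ fun z hz => ?_
          simp only [hF, Set.Finite.mem_toFinset, Set.mem_ofPred_eq, not_le] at hj
          rw [Metric.mem_closedBall, dist_comm] at hz
          have := dist_triangle (x j) z c
          simp [CoarseRoe.bump_apply, hR0 z (by linarith)]
        rw [h0, Finset.sum_eq_zero fun i hi => ?_]
        have hij : j ≠ i := fun h => hj (h ▸ hi)
        rw [mul_apply_eq_comp, blockProj_apply_of_ne b hij, map_zero]
    have h2 : ρ (bump χ hχ * f) = ∑ i ∈ F, blockProj b i * ρ (bump χ hχ * f) := by
      have := congrArg star h1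
      rw [star_sum, ← map_star, star_star] at this
      rw [this]
      refine Finset.sum_congr rfl fun i _ => ?_
      rw [star_mul, star_blockProj, ← map_star, star_star, ← this]
    rw [h2, Finset.mul_sum]
    refine Finset.sum_induction _ (fun A : H →L[𝕜] H => IsCompactOperator A)
      (fun A B hA hB => hA.add hB) isCompactOperator_zero fun i _ => ?_
    rw [← mul_assoc]
    exact (hT i).comp_clm _
  have hmem : T * ρ f ∈ closure {A : H →L[𝕜] H | IsCompactOperator A} := by
    rw [Metric.mem_closure_iff]
    intro ε hε
    obtain ⟨χ, hχ, hle⟩ := exists_bump_approx f (ε := ε / 2 / (‖T‖ + 1)) (by positivity)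
    refine ⟨_, hcpt χ hχ, ?_⟩
    rw [dist_eq_norm, ← mul_sub, ← map_sub]
    calc ‖T * ρ (f - bump χ hχ * f)‖ ≤ ‖T‖ * ‖ρ (f - bump χ hχ * f)‖ := norm_mul_le _ _
      _ ≤ (‖T‖ + 1) * (ε / 2 / (‖T‖ + 1)) := by
          gcongr
          · linarith
          · exact (norm_rep_le ρ _).trans hle
      _ < ε := by
          rw [mul_div_cancel₀ _ (by positivity)]
          linarith
  exact isClosed_setOfPred_isCompactOperator.closure_subset hmem

/-- Compactness of `ρ f * T` is compactness of its adjoint `star T * ρ (star f)`; this is why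
`IsBlockCompact` also constrains `star T`. -/
lemma IsLocalized.isLocallyCompact_iff (hb : IsLocalized ρ b x r) (hρ : IsNondegenerate ρ)
    (hfin : ∀ (c : X) (R : ℝ), {i | dist (x i) c ≤ R}.Finite) {T : H →L[𝕜] H} :
    IsLocallyCompact ρ T ↔ IsBlockCompact b T := by
  constructor
  · have key {S : H →L[𝕜] H} (hS : IsLocallyCompact ρ S) (i : ι) :
        IsCompactOperator (S * blockProj b i) := by
      obtain ⟨χ, hχ, hχ1, -⟩ := exists_bump_ball (x i) r
      have h1 : blockProj b i = ρ (bump χ hχ) * blockProj b i := by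
        refine b.clm_ext fun ⟨j, n⟩ => ?_
        rw [mul_apply_eq_comp]
        by_cases hj : j = i
        · rw [hj, blockProj_apply_self, hb.bump_apply hρ hχ hχ1]
        · rw [blockProj_apply_of_ne b hj, map_zero]
      rw [h1, ← mul_assoc]
      exact (hS (bump χ hχ)).2.comp_clm _
    exact fun hT i => ⟨key hT i, key hT.star i⟩
  · intro hT f
    refine ⟨?_, hb.isCompactOperator_mul_rep hfin (fun i => (hT i).1) f⟩
    have := isCompactOperator_star
      (hb.isCompactOperator_mul_rep hfin (fun i => (hT i).2) (star f))
    rwa [star_mul, star_star, ← map_star, star_star] at this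

end Localized

/-! ### Conjugation by a unitary matching two localized bases -/

section Transport

variable {𝕜 : Type*} [RCLike 𝕜] {X Y : Type*} [MetricSpace X] [MetricSpace Y]
  {H₁ : Type*} [NormedAddCommGroup H₁] [InnerProductSpace 𝕜 H₁] [CompleteSpace H₁]
  {H₂ : Type*} [NormedAddCommGroup H₂] [InnerProductSpace 𝕜 H₂] [CompleteSpace H₂]
  {ι : Type*} {b₁ : HilbertBasis (ι × ℕ) 𝕜 H₁} {b₂ : HilbertBasis (ι × ℕ) 𝕜 H₂}
  {x : ι → X} {y : ι → Y} {V : H₁ ≃ₗᵢ[𝕜] H₂}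

/-- The matrix entries do not change; only the width of the band is measured in another metric. -/
lemma IsBanded.conj {T : H₁ →L[𝕜] H₁} (hT : IsBanded b₁ x T) (hV : ∀ p, V (b₁ p) = b₂ p)
    (hxy : ∀ R : ℝ, ∃ S : ℝ, ∀ i j, dist (x i) (x j) ≤ R → dist (y i) (y j) ≤ S) :
    IsBanded b₂ y (V.conjStarAlgEquiv T) := by
  obtain ⟨R, hR⟩ := hT
  obtain ⟨S, hS⟩ := hxy R
  refine ⟨S, fun i j n m hij => ?_⟩
  rw [V.conjStarAlgEquiv_apply_apply, ← hV, ← hV, V.symm_apply_apply, V.inner_map_map]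
  exact hR i j n m (lt_of_not_ge fun h => (hS i j h).not_gt hij)

lemma conj_blockProj (hV : ∀ p, V (b₁ p) = b₂ p) (i : ι) :
    V.conjStarAlgEquiv (blockProj b₁ i) = blockProj b₂ i := by
  refine b₂.clm_ext fun ⟨j, n⟩ => ?_
  rw [V.conjStarAlgEquiv_apply_apply, ← hV, V.symm_apply_apply, hV]
  by_cases hj : j = i
  · rw [hj, blockProj_apply_self, blockProj_apply_self, hV]
  · rw [blockProj_apply_of_ne _ hj, blockProj_apply_of_ne _ hj, map_zero]

lemma isCompactOperator_conj (V : H₁ ≃ₗᵢ[𝕜] H₂) {T : H₁ →L[𝕜] H₁} (hT : IsCompactOperator T) :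
    IsCompactOperator (V.conjStarAlgEquiv T) :=
  (hT.comp_clm (V.symm : H₂ →L[𝕜] H₁)).clm_comp (V : H₁ →L[𝕜] H₂)

lemma IsBlockCompact.conj {T : H₁ →L[𝕜] H₁} (hT : IsBlockCompact b₁ T)
    (hV : ∀ p, V (b₁ p) = b₂ p) : IsBlockCompact b₂ (V.conjStarAlgEquiv T) := fun i => by
  rw [← conj_blockProj hV, ← map_star, ← map_mul, ← map_mul]
  exact ⟨isCompactOperator_conj V (hT i).1, isCompactOperator_conj V (hT i).2⟩

variable [ProperSpace X] [ProperSpace Y] {ρ₁ : C₀(X, 𝕜) →⋆ₙₐ[𝕜] (H₁ →L[𝕜] H₁)}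
  {ρ₂ : C₀(Y, 𝕜) →⋆ₙₐ[𝕜] (H₂ →L[𝕜] H₂)} {r₁ r₂ : ℝ}

/-- Conjugation by a unitary matching localized bases maps one Roe algebra into the other. -/
lemma conj_mem_roeAlgebra (hρ₁ : IsNondegenerate ρ₁) (hρ₂ : IsNondegenerate ρ₂)
    (hb₁ : IsLocalized ρ₁ b₁ x r₁) (hb₂ : IsLocalized ρ₂ b₂ y r₂)
    (hfin₁ : ∀ (c : X) (R : ℝ), {i | dist (x i) c ≤ R}.Finite)
    (hfin₂ : ∀ (c : Y) (R : ℝ), {i | dist (y i) c ≤ R}.Finite)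
    (hxy : ∀ R : ℝ, ∃ S : ℝ, ∀ i j, dist (x i) (x j) ≤ R → dist (y i) (y j) ≤ S)
    (hV : ∀ p, V (b₁ p) = b₂ p) {T : H₁ →L[𝕜] H₁} (hT : T ∈ roeAlgebra ρ₁ hρ₁) :
    V.conjStarAlgEquiv T ∈ roeAlgebra ρ₂ hρ₂ := by
  have hcont : Continuous V.conjStarAlgEquiv := by
    change Continuous fun T : H₁ →L[𝕜] H₁ => (V : H₁ →L[𝕜] H₂) ∘L T ∘L (V.symm : H₂ →L[𝕜] H₁)
    fun_prop
  have h := map_mem_closure hcont (s := (locallyCompactControlled ρ₁ hρ₁ : Set (H₁ →L[𝕜] H₁)))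
    (t := (locallyCompactControlled ρ₂ hρ₂ : Set (H₂ →L[𝕜] H₂))) hT
  -- On locally compact, controlled operators both conditions are translated into matrix form,
  -- transported, and translated back.
  exact h fun S ⟨hS₁, hS₂⟩ =>
    ⟨(hb₂.isLocallyCompact_iff hρ₂ hfin₂).2 (((hb₁.isLocallyCompact_iff hρ₁ hfin₁).1 hS₁).conj hV),
      (hb₂.isControlled_iff hρ₂).2 (((hb₁.isControlled_iff hρ₁).1 hS₂).conj hV hxy)⟩

end Transport

/-- Restriction of a `*`-isomorphism to subalgebras that correspond to each other. -/
def _root_.StarAlgEquiv.restrictNonUnital {R A B : Type*} [CommSemiring R] [NonUnitalRing A]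
    [NonUnitalRing B] [Module R A] [Module R B] [Star A] [Star B] (e : A ≃⋆ₐ[R] B)
    (S : NonUnitalStarSubalgebra R A) (T : NonUnitalStarSubalgebra R B)
    (h₁ : ∀ a ∈ S, e a ∈ T) (h₂ : ∀ b ∈ T, e.symm b ∈ S) : S ≃⋆ₐ[R] T where
  toFun a := ⟨e a, h₁ a a.2⟩
  invFun b := ⟨e.symm b, h₂ b b.2⟩
  left_inv a := Subtype.ext (e.symm_apply_apply a)
  right_inv b := Subtype.ext (e.apply_symm_apply b)
  map_mul' _ _ := Subtype.ext (map_mul e _ _)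
  map_add' _ _ := Subtype.ext (map_add e _ _)
  map_star' _ := Subtype.ext (map_star e _)
  map_smul' c _ := Subtype.ext (map_smul e c _)

/-! ### Matching nets from a coarse equivalence -/

section CoarseEquivalence

variable {X Y : Type*} [MetricSpace X] [MetricSpace Y] [MeasurableSpace X] [MeasurableSpace Y]

/-- Coarsely equivalent spaces contain matching separated nets. -/
lemma CoarselyEquivalent.exists_nets (h : CoarselyEquivalent X Y) :
    ∃ (A : Set X) (f : X → Y) (s t r : ℝ), 0 < s ∧ 0 < t ∧
      (Pairwise fun i j : A => s ≤ dist (i : X) j) ∧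
      (Pairwise fun i j : A => t ≤ dist (f i) (f j)) ∧
      (∀ z, ∃ i : A, dist z (i : X) ≤ r) ∧ (∀ z, ∃ i : A, dist z (f i) ≤ r) ∧
      (∀ R : ℝ, ∃ S : ℝ, ∀ i j, dist i j ≤ R → dist (f i) (f j) ≤ S) ∧
      ∀ R : ℝ, ∃ S : ℝ, ∀ i j, dist (f i) (f j) ≤ R → dist i j ≤ S := by
  obtain ⟨f, hf, g, hg, ⟨C, hC, hgf⟩, D, hD, hfg⟩ := h
  have hback (R : ℝ) : ∃ S : ℝ, 0 < S ∧ ∀ i j, dist (f i) (f j) ≤ R → dist i j ≤ S := by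
    -- Expansiveness is stated for positive radii, hence the maximum. Replacing `g (f i)` and `g (f
    -- j)` by `i` and `j` costs `C` each.
    obtain ⟨S, hS, h⟩ := hg.expansive (max R 1) (by positivity)
    refine ⟨S + 2 * C, by positivity, fun i j hij => ?_⟩
    have h1 := h _ _ (hij.trans (le_max_left _ _))
    have h2 : dist (g (f i)) i < C := hgf i
    have h3 : dist (g (f j)) j < C := hgf j
    have h4 := dist_triangle4_left (g (f i)) (g (f j)) i j
    linarith
  -- With this `s`, points more than `s` apart have images more than `1` apart, so an `s`-separated
  -- net has a separated image.
  obtain ⟨s, hs, h1⟩ := hback 1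
  obtain ⟨A, hA, hA'⟩ := exists_separated_net (X := X) s hs
  obtain ⟨r, hr, h2⟩ := hf.expansive s hs
  refine ⟨A, f, s, 1, max s (r + D), hs, one_pos, fun i j hij => ?_, fun i j hij => ?_,
    fun z => ?_, fun z => ?_, fun R => ?_, fun R => ?_⟩
  · exact (hA i.2 j.2 (Subtype.coe_ne_coe.2 hij)).le
  · by_contra! hlt
    exact (hA i.2 j.2 (Subtype.coe_ne_coe.2 hij)).not_ge (h1 _ _ hlt.le)
  · obtain ⟨a, ha, hza⟩ := hA' z
    exact ⟨⟨a, ha⟩, hza.trans (le_max_left _ _)⟩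
  -- The point `z` is within `D` of `f (g z)`, which is within `r` of `f a` because `g z` is within
  -- `s` of `a`.
  · obtain ⟨a, ha, hza⟩ := hA' (g z)
    refine ⟨⟨a, ha⟩, le_max_of_le_right ?_⟩
    have h3 : dist (f (g z)) z < D := hfg z
    have h4 := h2 _ _ hza
    have h5 := dist_triangle_left z (f a) (f (g z))
    change dist z (f a) ≤ _
    linarith
  · obtain ⟨S, -, hS⟩ := hf.expansive (max R 1) (by positivity)
    exact ⟨S, fun i j hij => hS i j (hij.trans (le_max_left _ _))⟩
  · obtain ⟨S, -, hS⟩ := hback R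
    exact ⟨S, hS⟩

end CoarseEquivalence

end CoarseRoe

theorem mainTheorem8 (𝕜 : Type*) [RCLike 𝕜]
    (X : Type*) [MetricSpace X] [ProperSpace X] [MeasurableSpace X] [BorelSpace X]
    (Y : Type*) [MetricSpace Y] [ProperSpace Y] [MeasurableSpace Y] [BorelSpace Y]
    (hXY : CoarseRoe.CoarselyEquivalent X Y)
    (H₁ : Type*) [NormedAddCommGroup H₁] [InnerProductSpace 𝕜 H₁] [CompleteSpace H₁]
    [TopologicalSpace.SeparableSpace H₁]
    (H₂ : Type*) [NormedAddCommGroup H₂] [InnerProductSpace 𝕜 H₂] [CompleteSpace H₂]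
    [TopologicalSpace.SeparableSpace H₂]
    (ρ₁ : C₀(X, 𝕜) →⋆ₙₐ[𝕜] (H₁ →L[𝕜] H₁)) (hρ₁ : CoarseRoe.IsNondegenerate ρ₁)
    (hρ₁' : CoarseRoe.IsAmple ρ₁)
    (ρ₂ : C₀(Y, 𝕜) →⋆ₙₐ[𝕜] (H₂ →L[𝕜] H₂)) (hρ₂ : CoarseRoe.IsNondegenerate ρ₂)
    (hρ₂' : CoarseRoe.IsAmple ρ₂) :
    Nonempty (CoarseRoe.roeAlgebra ρ₁ hρ₁ ≃⋆ₐ[𝕜] CoarseRoe.roeAlgebra ρ₂ hρ₂) := by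
  obtain ⟨A, f, s, t, r, hs, ht, hsep₁, hsep₂, hr₁, hr₂, hfor, hback⟩ := hXY.exists_nets
  obtain ⟨b₁, hb₁⟩ := CoarseRoe.exists_isLocalized hρ₁ hρ₁' (x := ((↑) : A → X)) hs hsep₁ hr₁
  obtain ⟨b₂, hb₂⟩ := CoarseRoe.exists_isLocalized hρ₂ hρ₂' (x := fun i : A => f i) ht hsep₂ hr₂
  have hfin₁ := CoarseRoe.finite_setOf_dist_le hs hsep₁
  have hfin₂ := CoarseRoe.finite_setOf_dist_le ht hsep₂
  -- Both bases are indexed by `A × ℕ`, so their coordinates identify the two spaces with the same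
  -- `ℓ²` space.
  let V : H₁ ≃ₗᵢ[𝕜] H₂ := b₁.repr.trans b₂.repr.symm
  have hV : ∀ p, V (b₁ p) = b₂ p := fun p => by
    classical
    simp only [V, LinearIsometryEquiv.trans_apply]
    rw [b₁.repr_self, b₂.repr_symm_single]
  have hV' : ∀ p, V.symm (b₂ p) = b₁ p := fun p => by rw [← hV, V.symm_apply_apply]
  refine ⟨V.conjStarAlgEquiv.restrictNonUnital _ _ (fun T hT => ?_) fun T hT => ?_⟩
  · refine CoarseRoe.conj_mem_roeAlgebra hρ₁ hρ₂ hb₁ hb₂ hfin₁ hfin₂ (fun R => ?_) hV hT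
    obtain ⟨S, hS⟩ := hfor R
    exact ⟨S, fun i j => hS i j⟩
  · refine CoarseRoe.conj_mem_roeAlgebra hρ₂ hρ₁ hb₂ hb₁ hfin₂ hfin₁ (fun R => ?_) hV' hT
    obtain ⟨S, hS⟩ := hback R
    exact ⟨S, fun i j => hS i j⟩
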